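/- A residuated lattice is an algebra $\mathbf A=\langle A,\wedge,\vee,\cdot,\backslash,/,\mathrm e\rangle$ such that $\langle A,\wedge,\vee\rangle$ is a lattice, $\langle A,\cdot,\mathrm e\rangle$ is a monoid, and $y\le x\backslash z \iff x\cdot y\le z\iff x\le z/y$ for all $x,y,z\in A$. It is totally ordered if its lattice order is total. A bounded residuated lattice is an expansion of a residuated lattice by two constants $\bot,\top$ naming a least and a greatest element; an involutive residuated lattice is an expansion by a constant $\mathrm f$ with $\mathrm f/(x\backslash \mathrm f)=x=(\mathrm f/x)\backslash \mathrm f$ for all $x$; a bounded involutive residuated lattice has both kinds of constants. Subalgebras, homomorphisms, congruences and varieties are understood in the respective signature, so that subalgebras contain, and homomorphisms preserve, all constants of the signature. An algebra is simple if it has no congruences other than the identity and the full relation. An algebra $\mathbf A$ has the congruence extension property (CEP) if for every subalgebra $\mathbf B\le\mathbf A$ and every congruence $\Theta$ of $\mathbf B$ there is a congruence $\Phi$ of $\mathbf A$ with $\Phi\cap B^2=\Theta$. A class $\mathsf K$ of similar algebras has the amalgamation property (AP) if for all $\mathbf B,\mathbf C,\mathbf D\in\mathsf K$ and all injective homomorphisms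 $\varphi_1\colon\mathbf B\to\mathbf C$ and $\varphi_2\colon\mathbf B\to\mathbf D$ there are $\mathbf E\in\mathsf K$ and injective homomorphisms $\psi_1\colon\mathbf C\to\mathbf E$ and $\psi_2\colon\mathbf D\to\mathbf E$ with $\psi_1\circ\varphi_1=\psi_2\circ\varphi_2$. **Proposition.** Let $\mathbf A$ be a finite simple totally ordered residuated lattice, or a finite simple totally ordered bounded, involutive, or bounded involutive residuated lattice, and let $\mathsf V(\mathbf A)$ be the variety generated by $\mathbf A$, that is, the smallest class of algebras of the same signature that contains $\mathbf A$ and is closed under homomorphic images, subalgebras and direct products. Then $\mathsf V(\mathbf A)$ has the AP if and only if $\mathbf A$ has the CEP and no two distinct subalgebras of $\mathbf A$ are isomorphic. -/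

import Mathlib

open scoped FirstOrder

universe u

namespace UnivAlg

/-! Universal algebra over a signature, i.e. a first-order language `L` without relation symbols
(`L.IsAlgebraic`). An algebra is an `L.Structure`, a homomorphism is `A →[L] B`, an injective
homomorphism is `A ↪[L] B`, an isomorphism is `A ≃[L] B` and a subalgebra is an
`L.Substructure`. -/

/-- A congruence of an algebra: an equivalence relation compatible with all basic operations. -/
structure Congruence (L : FirstOrder.Language.{0, 0}) [L.IsAlgebraic] (A : Type u) [L.Structure A]
    extends Setoid A where
  compat : ∀ {n : ℕ} (g : L.Functions n) (x y : Fin n → A),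
    (∀ k, toSetoid (x k) (y k)) →
      toSetoid (FirstOrder.Language.Structure.funMap g x) (FirstOrder.Language.Structure.funMap g y)

/-- `A` is simple: its only congruences are the identity relation `⊥` and the full relation `⊤`.
(One-element algebras are allowed.) -/
def IsSimple (L : FirstOrder.Language.{0, 0}) [L.IsAlgebraic] (A : Type u) [L.Structure A] : Prop :=
  ∀ Θ : Congruence L A, Θ.toSetoid = ⊥ ∨ Θ.toSetoid = ⊤

/-- The congruence extension property of a single algebra `A`: every congruence `Θ` of a
subalgebra `B` of `A` is of the form `Φ ∩ B²` for a congruence `Φ` of `A`. -/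
def HasCEP (L : FirstOrder.Language.{0, 0}) [L.IsAlgebraic] (A : Type u) [L.Structure A] : Prop :=
  ∀ (B : L.Substructure A) (Θ : Congruence L B),
    ∃ Φ : Congruence L A, ∀ x y : B, Φ.toSetoid (x : A) (y : A) ↔ Θ.toSetoid x y

/-- No two distinct subalgebras of `A` are isomorphic. -/
def NoDistinctIsoSubalgebras (L : FirstOrder.Language.{0, 0}) [L.IsAlgebraic] (A : Type u) [L.Structure A] :
    Prop :=
  ∀ B C : L.Substructure A, Nonempty (B ≃[L] C) → B = C

/-- The direct product of a family of algebras, with coordinatewise operations. -/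
instance piStructure (L : FirstOrder.Language.{0, 0}) [L.IsAlgebraic] {I : Type u} (B : I → Type u)
    [∀ i, L.Structure (B i)] : L.Structure (∀ i, B i) where
  funMap g x := fun i => FirstOrder.Language.Structure.funMap g (fun k => x k i)
  RelMap r := isEmptyElim r

/-- A class of algebras of signature `L`. -/
abbrev AlgClass (L : FirstOrder.Language.{0, 0}) := ∀ (B : Type u) [L.Structure B], Prop

/-- A variety: a class of algebras closed under homomorphic images, subalgebras and
(arbitrary, possibly empty) direct products. -/
structure IsVariety (L : FirstOrder.Language.{0, 0}) [L.IsAlgebraic] (K : AlgClass.{u} L) : Prop where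
  hom_image : ∀ (B C : Type u) [L.Structure B] [L.Structure C] (h : B →[L] C),
    Function.Surjective h → K B → K C
  subalgebra : ∀ (B : Type u) [L.Structure B] (S : L.Substructure B), K B → K S
  product : ∀ (I : Type u) (B : I → Type u) [∀ i, L.Structure (B i)],
    (∀ i, K (B i)) → K (∀ i, B i)

/-- `V(A)`, the variety generated by `A`: `B` belongs to it iff `B` belongs to every variety that
contains `A`. -/
def VarietyGen (L : FirstOrder.Language.{0, 0}) [L.IsAlgebraic] (A : Type u) [L.Structure A] :
    AlgClass.{u} L :=
  fun B _ => ∀ K : AlgClass.{u} L, IsVariety L K → K A → K B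

/-- The amalgamation property of a class `K` of similar algebras: every span of injective
homomorphisms `φ₁ : A → B`, `φ₂ : A → C` in `K` has an amalgam, i.e. injective homomorphisms
`ψ₁ : B → D`, `ψ₂ : C → D` with `D` in `K` and `ψ₁ ∘ φ₁ = ψ₂ ∘ φ₂`. -/
def HasAP (L : FirstOrder.Language.{0, 0}) [L.IsAlgebraic] (K : AlgClass.{u} L) : Prop :=
  ∀ (A B C : Type u) [L.Structure A] [L.Structure B] [L.Structure C],
    K A → K B → K C → ∀ (φ₁ : A ↪[L] B) (φ₂ : A ↪[L] C),
      ∃ (D : Type u) (_ : L.Structure D) (ψ₁ : B ↪[L] D) (ψ₂ : C ↪[L] D),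
        K D ∧ ∀ a : A, ψ₁ (φ₁ a) = ψ₂ (φ₂ a)

end UnivAlg

namespace ResLat

/-- Basic operation symbols of residuated lattices, of arities `(2,2,2,2,2,0)`, together with
constants for the bounds when `bdd = true`, and a negation constant when `inv = true`. -/
inductive Op (bdd inv : Bool) : ℕ → Type
  | meet : Op bdd inv 2
  | join : Op bdd inv 2
  | mul : Op bdd inv 2
  | ldiv : Op bdd inv 2
  | rdiv : Op bdd inv 2
  | unit : Op bdd inv 0
  | bot : bdd = true → Op bdd inv 0
  | top : bdd = true → Op bdd inv 0
  | neg : inv = true → Op bdd inv 0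

/-- The signature of (bounded and/or involutive) residuated lattices. -/
def sig (bdd inv : Bool) : FirstOrder.Language.{0, 0} where
  Functions := Op bdd inv
  Relations := fun _ => Empty

instance (bdd inv : Bool) : (sig bdd inv).IsAlgebraic := fun _ => inferInstanceAs (IsEmpty Empty)

section Operations

variable {bdd inv : Bool} {A : Type u} [(sig bdd inv).Structure A]

/-- The value of a binary basic operation. -/
def op₂ (g : Op bdd inv 2) (x y : A) : A :=
  FirstOrder.Language.Structure.funMap (L := sig bdd inv) (n := 2) g ![x, y]

/-- The value of a constant. -/
def op₀ (A : Type u) [(sig bdd inv).Structure A] (g : Op bdd inv 0) : A :=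
  FirstOrder.Language.Structure.funMap (L := sig bdd inv) (n := 0) g ![]

end Operations

/-- `A` is a residuated lattice; a bounded one if `bdd = true`, and an involutive one if
`inv = true`. The order is the lattice order, `x ≤ y` iff `x ∧ y = x`. -/
structure IsResiduatedLattice (bdd inv : Bool) (A : Type u) [(sig bdd inv).Structure A] :
    Prop where
  meet_comm : ∀ x y : A, op₂ (.meet : Op bdd inv 2) x y = op₂ (.meet : Op bdd inv 2) y x
  meet_assoc : ∀ x y z : A,
    op₂ (.meet : Op bdd inv 2) (op₂ (.meet : Op bdd inv 2) x y) z =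
      op₂ (.meet : Op bdd inv 2) x (op₂ (.meet : Op bdd inv 2) y z)
  join_comm : ∀ x y : A, op₂ (.join : Op bdd inv 2) x y = op₂ (.join : Op bdd inv 2) y x
  join_assoc : ∀ x y z : A,
    op₂ (.join : Op bdd inv 2) (op₂ (.join : Op bdd inv 2) x y) z =
      op₂ (.join : Op bdd inv 2) x (op₂ (.join : Op bdd inv 2) y z)
  meet_join : ∀ x y : A,
    op₂ (.meet : Op bdd inv 2) x (op₂ (.join : Op bdd inv 2) x y) = x
  join_meet : ∀ x y : A,
    op₂ (.join : Op bdd inv 2) x (op₂ (.meet : Op bdd inv 2) x y) = x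
  mul_assoc : ∀ x y z : A,
    op₂ (.mul : Op bdd inv 2) (op₂ (.mul : Op bdd inv 2) x y) z =
      op₂ (.mul : Op bdd inv 2) x (op₂ (.mul : Op bdd inv 2) y z)
  one_mul : ∀ x : A, op₂ (.mul : Op bdd inv 2) (op₀ A (.unit : Op bdd inv 0)) x = x
  mul_one : ∀ x : A, op₂ (.mul : Op bdd inv 2) x (op₀ A (.unit : Op bdd inv 0)) = x
  /-- `y ≤ x \ z` iff `x · y ≤ z` -/
  le_ldiv_iff : ∀ x y z : A,
    op₂ (.meet : Op bdd inv 2) y (op₂ (.ldiv : Op bdd inv 2) x z) = y ↔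
      op₂ (.meet : Op bdd inv 2) (op₂ (.mul : Op bdd inv 2) x y) z =
        op₂ (.mul : Op bdd inv 2) x y
  /-- `x ≤ z / y` iff `x · y ≤ z` -/
  le_rdiv_iff : ∀ x y z : A,
    op₂ (.meet : Op bdd inv 2) x (op₂ (.rdiv : Op bdd inv 2) z y) = x ↔
      op₂ (.meet : Op bdd inv 2) (op₂ (.mul : Op bdd inv 2) x y) z =
        op₂ (.mul : Op bdd inv 2) x y
  /-- `⊥ ≤ x` -/
  bot_le : ∀ (h : bdd = true) (x : A),
    op₂ (.meet : Op bdd inv 2) (op₀ A (.bot h : Op bdd inv 0)) x =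
      op₀ A (.bot h : Op bdd inv 0)
  /-- `x ≤ ⊤` -/
  le_top : ∀ (h : bdd = true) (x : A),
    op₂ (.meet : Op bdd inv 2) x (op₀ A (.top h : Op bdd inv 0)) = x
  /-- `f / (x \ f) = x` -/
  left_involutive : ∀ (h : inv = true) (x : A),
    op₂ (.rdiv : Op bdd inv 2) (op₀ A (.neg h : Op bdd inv 0))
      (op₂ (.ldiv : Op bdd inv 2) x (op₀ A (.neg h : Op bdd inv 0))) = x
  /-- `(f / x) \ f = x` -/
  right_involutive : ∀ (h : inv = true) (x : A),
    op₂ (.ldiv : Op bdd inv 2)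
      (op₂ (.rdiv : Op bdd inv 2) (op₀ A (.neg h : Op bdd inv 0)) x)
      (op₀ A (.neg h : Op bdd inv 0)) = x

/-- The lattice order of `A` is total: `x ≤ y` or `y ≤ x` for all `x`, `y`. -/
def IsTotallyOrdered (bdd inv : Bool) (A : Type u) [(sig bdd inv).Structure A] : Prop :=
  ∀ x y : A, op₂ (.meet : Op bdd inv 2) x y = x ∨ op₂ (.meet : Op bdd inv 2) y x = y

end ResLat

/-!
The argument has two ingredients. The first is Jónsson's lemma, in the special form that is needed
here: lattices have a majority term, so congruence lattices are distributive
(`IsMajority.sup_inf_sup_le`), and a congruence of a subalgebra `B` of `D ≤ A ^ I` that is maximal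
among those omitting a given pair contains the restriction to `B` of the kernel of some homomorphism
`D → A`, an ultralimit of projections (`exists_hom_ker_le`). Consequently the algebras in `V(A)` are
separated by homomorphisms to homomorphic images of subalgebras of `A`
(`VarietyGen.exists_hom_separating`). The second ingredient is rigidity: homomorphisms to a finite
chain are determined by their kernel and their range (`isRigid`), because a finite chain has only
one order automorphism.

Suppose that `A` has the CEP and no two distinct isomorphic subalgebras. As `A` is simple, so are
all its subalgebras, and hence `V(A)` consists of the subalgebras of powers of `A`. In this class
`A` is injective (`exists_hom_extension`): given `B ≤ D` and `h : B → A`, Jónsson's lemma and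
simplicity provide `g : D → A` whose restriction to `B` has the same kernel as `h`; the two ranges
are then isomorphic, so they are equal, and `g` extends `h` by rigidity. A span with vertex `B` and
sides `C` and `D` is thus amalgamated in the power of `A` over all pairs of homomorphisms `C → A`,
`D → A` that agree on `B` (`hasAP_of_hasCEP`).

Suppose that `V(A)` has the AP. Amalgamate an isomorphism `σ : S → T` of subalgebras of `A` and map
the amalgam to some `Q` of at most `|A|` elements so that the first copy of `A` is mapped
bijectively. If the second copy is mapped bijectively too, then `σ` extends to an automorphism of
`A`, which is the identity by rigidity; otherwise it is mapped to one element and `σ` is trivial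
(`noDistinctIsoSubalgebras_of_hasAP`). For the CEP it suffices that all subalgebras `S` of `A` are
simple. If `Θ` is a congruence of `S` other than the identity and the full relation, then the
inclusion of `S` in `A` and the embedding `s ↦ (s, s/Θ)` of `S` into `S × S/Θ` cannot be
amalgamated (`isSimple_substructure_of_hasAP`), because a homomorphism from `S × S` to a chain
depends on one coordinate only (`depends_on_one_coordinate`).
-/

namespace UnivAlg

open FirstOrder FirstOrder.Language

/-! ### Congruences, kernels and quotients -/

variable {L : FirstOrder.Language.{0, 0}}

/-- The range restriction of a homomorphism. -/
def rangeRestrict {B A : Type u} [L.Structure B] [L.Structure A] (f : B →[L] A) :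
    B →[L] f.range := f.codRestrict f.range f.mem_range_self

theorem rangeRestrict_coe {B A : Type u} [L.Structure B] [L.Structure A] (f : B →[L] A) (x : B) :
    (rangeRestrict f x : A) = f x := rfl

theorem rangeRestrict_surjective {B A : Type u} [L.Structure B] [L.Structure A] (f : B →[L] A) :
    Function.Surjective (rangeRestrict f) := by
  rintro ⟨_, ⟨x, rfl⟩⟩
  exact ⟨x, rfl⟩

variable [L.IsAlgebraic]

namespace Congruence

variable {A B : Type u} [L.Structure A] [L.Structure B]

/-- The kernel of a homomorphism. -/
def ker (f : A →[L] B) : Congruence L A where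
  toSetoid := Setoid.ker f
  compat g x y h := by
    have h' : f ∘ x = f ∘ y := funext h
    change f _ = f _
    rw [f.map_fun, f.map_fun, h']

/-- The congruence that `Θ` induces on the source of a homomorphism. -/
def comap (f : A →[L] B) (Θ : Congruence L B) : Congruence L A where
  toSetoid := Setoid.comap f Θ.toSetoid
  compat g x y h := by
    change Θ.toSetoid (f _) (f _)
    rw [f.map_fun, f.map_fun]
    exact Θ.compat g _ _ h

/-- The meet of two congruences. -/
def inf (Θ Ψ : Congruence L A) : Congruence L A where
  toSetoid := Θ.toSetoid ⊓ Ψ.toSetoid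
  compat g x y h := ⟨Θ.compat g x y fun k => (h k).1, Ψ.compat g x y fun k => (h k).2⟩

/-- An equivalence relation is compatible with an operation as soon as it is so in each argument
separately. -/
theorem compat_of_update {n : ℕ} (s : Setoid A) (F : (Fin n → A) → A)
    (h : ∀ (k : Fin n) (x : Fin n → A) (a b : A), s a b →
      s (F (Function.update x k a)) (F (Function.update x k b)))
    (x y : Fin n → A) (hxy : ∀ k, s (x k) (y k)) : s (F x) (F y) := by
  classical
  have key : ∀ t : Finset (Fin n), s (F x) (F (t.piecewise y x)) := by
    intro t
    induction t using Finset.induction_on with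
    | empty => simp
    | insert k t hk ih =>
      refine s.trans ih ?_
      rw [Finset.piecewise_insert]
      have := h k (t.piecewise y x) (x k) (y k) (hxy k)
      rwa [show x k = t.piecewise y x k by simp [hk], Function.update_eq_self] at this
  simpa using key Finset.univ

/-- The join of two congruences, which is their join as equivalence relations. -/
def sup (Θ Ψ : Congruence L A) : Congruence L A where
  toSetoid := Θ.toSetoid ⊔ Ψ.toSetoid
  compat {n} g := by
    refine compat_of_update _ _ fun k x a b hab => ?_
    have hup : ∀ (Φ : Congruence L A) (u v : A), Φ.toSetoid u v →
        Φ.toSetoid (Structure.funMap g (Function.update x k u))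
          (Structure.funMap g (Function.update x k v)) := by
      intro Φ u v huv
      refine Φ.compat g _ _ fun j => ?_
      by_cases hj : j = k
      · subst hj; simpa using huv
      · simp [hj]
    have hle : Θ.toSetoid ⊔ Ψ.toSetoid ≤ Setoid.comap
        (fun u => Structure.funMap g (Function.update x k u)) (Θ.toSetoid ⊔ Ψ.toSetoid) :=
      sup_le
        (Setoid.le_def.2 fun {u v} huv =>
          Setoid.le_def.1 (le_sup_left : Θ.toSetoid ≤ Θ.toSetoid ⊔ Ψ.toSetoid) (hup Θ u v huv))
        (Setoid.le_def.2 fun {u v} huv =>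
          Setoid.le_def.1 (le_sup_right : Ψ.toSetoid ≤ Θ.toSetoid ⊔ Ψ.toSetoid) (hup Ψ u v huv))
    exact Setoid.le_def.1 hle hab

/-- The quotient algebra `A / Θ`. -/
def Quot (Θ : Congruence L A) : Type u := Quotient Θ.toSetoid

noncomputable instance (Θ : Congruence L A) : L.Structure Θ.Quot where
  funMap g x := Quotient.mk Θ.toSetoid (Structure.funMap g fun k => Quotient.out (x k))
  RelMap r := isEmptyElim r

/-- The canonical homomorphism onto a quotient algebra. -/
def proj (Θ : Congruence L A) : A →[L] Θ.Quot where
  toFun := Quotient.mk Θ.toSetoid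
  map_fun' g x := Quotient.sound <| Θ.compat g _ _ fun k =>
    Θ.toSetoid.symm (Quotient.exact (Quotient.out_eq (Quotient.mk Θ.toSetoid (x k))))
  map_rel' r := isEmptyElim r

theorem proj_surjective (Θ : Congruence L A) : Function.Surjective Θ.proj := Quotient.mk_surjective

theorem proj_eq_iff (Θ : Congruence L A) (x y : A) : Θ.proj x = Θ.proj y ↔ Θ.toSetoid x y :=
  ⟨fun h => Quotient.exact h, fun h => Quotient.sound h⟩

/-- Every congruence that omits a pair extends to a maximal one that omits it. -/
theorem exists_maximal_omitting (Θ : Congruence L A) {a b : A} (hab : ¬ Θ.toSetoid a b) :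
    ∃ Ψ : Congruence L A, Θ.toSetoid ≤ Ψ.toSetoid ∧ ¬ Ψ.toSetoid a b ∧
      ∀ Φ : Congruence L A, Ψ.toSetoid ≤ Φ.toSetoid → ¬ Φ.toSetoid a b →
        Φ.toSetoid ≤ Ψ.toSetoid := by
  let S : Set (Setoid A) := {s | ∃ Φ : Congruence L A, Φ.toSetoid = s ∧ ¬ s a b}
  obtain ⟨m, hm, hmax⟩ := zorn_le_nonempty₀ S (by
    intro c hcS hc y hy
    have hne : Nonempty c := ⟨⟨y, hy⟩⟩
    have hdir : Directed (· ≤ ·) (fun s : c => (s : Setoid A)) :=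
      directedOn_iff_directed.1 hc.directedOn
    let t : Setoid A :=
      { r := fun u v => ∃ s : c, (s : Setoid A) u v
        iseqv :=
          { refl := fun u => ⟨⟨y, hy⟩, y.refl u⟩
            symm := fun ⟨s, hs⟩ => ⟨s, (s : Setoid A).symm hs⟩
            trans := fun ⟨s, hs⟩ ⟨s', hs'⟩ => by
              obtain ⟨z, hz, hz'⟩ := hdir s s'
              exact ⟨z, (z : Setoid A).trans (Setoid.le_def.1 hz hs) (Setoid.le_def.1 hz' hs')⟩ } }
    refine ⟨t, ⟨⟨t, ?_⟩, rfl, ?_⟩, fun z hz => Setoid.le_def.2 fun {u v} huv => ⟨⟨z, hz⟩, huv⟩⟩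
    · intro n g u v huv
      choose σ hσ using huv
      obtain ⟨z, hz⟩ := hdir.finite_le σ
      obtain ⟨Φ, hΦ, -⟩ := hcS z.2
      have hz' : ∀ k, Φ.toSetoid (u k) (v k) := fun k => by
        rw [hΦ]; exact Setoid.le_def.1 (hz k) (hσ k)
      have := Φ.compat g u v hz'
      rw [hΦ] at this
      exact ⟨z, this⟩
    · rintro ⟨s, hs⟩
      obtain ⟨_, _, h⟩ := hcS s.2
      exact h hs) Θ.toSetoid ⟨Θ, rfl, hab⟩
  obtain ⟨Ψ, rfl, hΨ⟩ := hmax.1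
  exact ⟨Ψ, hm, hΨ, fun Φ h h' => hmax.2 ⟨Φ, rfl, h'⟩ h⟩

end Congruence

/-- Surjective homomorphisms with the same kernel have isomorphic images. -/
theorem exists_equiv_of_ker_eq {B X Y : Type u} [L.Structure B] [L.Structure X] [L.Structure Y]
    (p : B →[L] X) (q : B →[L] Y) (hp : Function.Surjective p) (hq : Function.Surjective q)
    (h : ∀ x y, p x = p y ↔ q x = q y) :
    ∃ e : X ≃[L] Y, ∀ x, e (p x) = q x := by
  have hF : ∀ x, q (Function.surjInv hp (p x)) = q x := fun x =>
    (h _ _).1 (Function.surjInv_eq hp (p x))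
  refine ⟨{ toEquiv := Equiv.ofBijective (fun x => q (Function.surjInv hp x)) ⟨?_, ?_⟩
            map_fun' := ?_
            map_rel' := fun r => isEmptyElim r }, hF⟩
  · intro x y hxy
    have := (h _ _).2 hxy
    rwa [Function.surjInv_eq hp, Function.surjInv_eq hp] at this
  · intro y
    obtain ⟨x, rfl⟩ := hq y
    exact ⟨p x, hF x⟩
  · intro n g x
    change q (Function.surjInv hp (Structure.funMap g x)) =
      Structure.funMap g (q ∘ fun k => Function.surjInv hp (x k))
    rw [← q.map_fun, ← h, p.map_fun, Function.surjInv_eq hp]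
    congr 1
    funext k
    exact (Function.surjInv_eq hp (x k)).symm

/-- A homomorphism factors through a surjective one with a smaller kernel. -/
theorem exists_factor {B X Y : Type u} [L.Structure B] [L.Structure X] [L.Structure Y]
    (p : B →[L] X) (q : B →[L] Y) (hp : Function.Surjective p)
    (h : ∀ x y, p x = p y → q x = q y) :
    ∃ e : X →[L] Y, ∀ x, e (p x) = q x := by
  have hF : ∀ x, q (Function.surjInv hp (p x)) = q x := fun x =>
    h _ _ (Function.surjInv_eq hp (p x))
  refine ⟨{ toFun := fun x => q (Function.surjInv hp x)
            map_fun' := ?_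
            map_rel' := fun r => isEmptyElim r }, hF⟩
  intro n g x
  change q (Function.surjInv hp (Structure.funMap g x)) =
    Structure.funMap g (q ∘ fun k => Function.surjInv hp (x k))
  rw [← q.map_fun]
  apply h
  rw [p.map_fun, Function.surjInv_eq hp]
  congr 1
  funext k
  exact (Function.surjInv_eq hp (x k)).symm

/-! ### Jónsson's lemma for subpowers of a finite algebra -/

/-- `m` is a majority operation on `B` that all congruences of `B` preserve. -/
structure IsMajority (L : FirstOrder.Language.{0, 0}) [L.IsAlgebraic] {B : Type u} [L.Structure B]
    (m : B → B → B → B) : Prop where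
  left : ∀ x y, m x x y = x
  right : ∀ x y, m x y y = y
  outer : ∀ x y, m x y x = x
  compat : ∀ (Θ : Congruence L B) {x x' y y' z z' : B}, Θ.toSetoid x x' → Θ.toSetoid y y' →
    Θ.toSetoid z z' → Θ.toSetoid (m x y z) (m x' y' z')

theorem IsMajority.inf_sup_le {B : Type u} [L.Structure B] {m : B → B → B → B}
    (hm : IsMajority L m) (γ α β : Congruence L B) :
    γ.toSetoid ⊓ (α.toSetoid ⊔ β.toSetoid) ≤
      (γ.toSetoid ⊓ α.toSetoid) ⊔ (γ.toSetoid ⊓ β.toSetoid) := by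
  refine Setoid.le_def.2 fun {x y} ⟨hγ, hαβ⟩ => ?_
  have hin : ∀ (δ : Congruence L B) (u v : B), δ.toSetoid u v →
      (γ.toSetoid ⊓ δ.toSetoid) (m x u y) (m x v y) := by
    intro δ u v huv
    have hx : ∀ w, γ.toSetoid (m x w y) x := fun w => by
      have := hm.compat γ (γ.toSetoid.refl x) (γ.toSetoid.refl w) (γ.toSetoid.symm hγ)
      rwa [hm.outer] at this
    exact ⟨γ.toSetoid.trans (hx u) (γ.toSetoid.symm (hx v)),
      hm.compat δ (δ.toSetoid.refl x) huv (δ.toSetoid.refl y)⟩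
  -- `u ↦ m x u y` maps `α` and `β` into their restrictions to `γ`, and it fixes `x` and `y`.
  have hle : α.toSetoid ⊔ β.toSetoid ≤ Setoid.comap (fun u => m x u y)
      ((γ.toSetoid ⊓ α.toSetoid) ⊔ (γ.toSetoid ⊓ β.toSetoid)) :=
    sup_le
      (Setoid.le_def.2 fun {u v} h => Setoid.le_def.1
        (le_sup_left : _ ≤ (γ.toSetoid ⊓ α.toSetoid) ⊔ (γ.toSetoid ⊓ β.toSetoid)) (hin α u v h))
      (Setoid.le_def.2 fun {u v} h => Setoid.le_def.1
        (le_sup_right : _ ≤ (γ.toSetoid ⊓ α.toSetoid) ⊔ (γ.toSetoid ⊓ β.toSetoid)) (hin β u v h))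
  have := Setoid.le_def.1 hle hαβ
  rw [Setoid.comap_rel, hm.left, hm.right] at this
  exact this

theorem IsMajority.sup_inf_sup_le {B : Type u} [L.Structure B] {m : B → B → B → B}
    (hm : IsMajority L m) (θ α β : Congruence L B) :
    (θ.toSetoid ⊔ α.toSetoid) ⊓ (θ.toSetoid ⊔ β.toSetoid) ≤
      θ.toSetoid ⊔ (α.toSetoid ⊓ β.toSetoid) := by
  have h1 := hm.inf_sup_le (θ.sup β) θ α
  have h2 := hm.inf_sup_le α θ β
  change (θ.toSetoid ⊔ β.toSetoid) ⊓ (θ.toSetoid ⊔ α.toSetoid) ≤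
    ((θ.toSetoid ⊔ β.toSetoid) ⊓ θ.toSetoid) ⊔ ((θ.toSetoid ⊔ β.toSetoid) ⊓ α.toSetoid) at h1
  rw [inf_comm]
  refine h1.trans (sup_le (inf_le_right.trans le_sup_left) ?_)
  rw [inf_comm]
  exact h2.trans (sup_le (inf_le_right.trans le_sup_left) le_sup_right)

/-- The elements of `D` are separated by the homomorphisms from `D` to `A`; equivalently, `D` is
isomorphic to a subalgebra of a power of `A`. -/
def SeparatedBy (L : FirstOrder.Language.{0, 0}) [L.IsAlgebraic] (A D : Type u) [L.Structure A]
    [L.Structure D] : Prop :=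
  ∀ x y : D, x ≠ y → ∃ h : D →[L] A, h x ≠ h y

/-- The limit of homomorphisms to a finite algebra along an ultrafilter. -/
theorem exists_limit_hom {A D : Type u} [L.Structure A] [L.Structure D] [Finite A]
    (U : Ultrafilter (D →[L] A)) :
    ∃ g : D →[L] A, ∀ x, ∀ᶠ h : D →[L] A in U, h x = g x := by
  have hlim : ∀ x : D, ∃ a : A, ∀ᶠ h : D →[L] A in U, h x = a := by
    intro x
    obtain ⟨a, ha⟩ := Ultrafilter.eq_pure_of_finite (U.map fun h : D →[L] A => h x)
    refine ⟨a, ?_⟩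
    have : ({a} : Set A) ∈ U.map fun h : D →[L] A => h x := by
      rw [ha]; exact Ultrafilter.mem_pure.2 rfl
    exact this
  choose g hg using hlim
  refine ⟨⟨g, ?_, fun r => isEmptyElim r⟩, hg⟩
  intro n f x
  have h1 : ∀ᶠ h : D →[L] A in U, ∀ k, h (x k) = g (x k) := Filter.eventually_all.2 fun k => hg _
  obtain ⟨h, h1, h2⟩ := (h1.and (hg (Structure.funMap f x))).exists
  rw [← h2, h.map_fun]
  congr 1
  exact funext h1

/-- Jónsson's lemma. The sets `J` of homomorphisms `D → A` whose joint kernel on `B` does not lie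
below `θ` form a proper ideal, because `θ` is meet irreducible in a distributive congruence lattice,
and `g` is the limit along an ultrafilter that avoids this ideal. -/
theorem exists_hom_ker_le {A B D : Type u} [L.Structure A] [L.Structure B] [L.Structure D]
    [Finite A] (φ : B ↪[L] D) (hD : SeparatedBy L A D) {m : B → B → B → B} (hm : IsMajority L m)
    (θ : Congruence L B) {a b : B} (hab : ¬ θ.toSetoid a b)
    (hmax : ∀ Φ : Congruence L B, θ.toSetoid ≤ Φ.toSetoid → ¬ Φ.toSetoid a b →
      Φ.toSetoid ≤ θ.toSetoid) :
    ∃ g : D →[L] A, ∀ x y : B, g (φ x) = g (φ y) → θ.toSetoid x y := by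
  let K : Set (D →[L] A) → Congruence L B := fun J =>
    { r := fun x y => ∀ h ∈ J, h (φ x) = h (φ y)
      iseqv := ⟨fun _ _ _ => rfl, fun H h hh => (H h hh).symm,
        fun H H' h hh => (H h hh).trans (H' h hh)⟩
      compat := fun g x y H h hh => by
        rw [φ.map_fun, φ.map_fun, h.map_fun, h.map_fun]
        congr 1
        exact funext fun k => H k h hh }
  have hsup : ∀ J, ¬ (K J).toSetoid ≤ θ.toSetoid → (θ.toSetoid ⊔ (K J).toSetoid) a b := by
    intro J hJ
    by_contra hcon
    exact hJ (le_sup_right.trans (hmax (θ.sup (K J)) le_sup_left hcon))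
  have hanti : ∀ {J J'}, J ⊆ J' → (K J').toSetoid ≤ (K J).toSetoid := fun hJ =>
    Setoid.le_def.2 fun {x y} H h hh => H h (hJ hh)
  let F : Filter (D →[L] A) :=
    { sets := {J | ¬ (K Jᶜ).toSetoid ≤ θ.toSetoid}
      univ_sets := by
        intro hle
        exact hab (Setoid.le_def.1 hle fun h hh => absurd (Set.mem_univ h) hh)
      sets_of_superset := fun hJ hJJ' hle =>
        hJ ((hanti (Set.compl_subset_compl.2 hJJ')).trans hle)
      inter_sets := by
        intro J J' hJ hJ' hle
        have hd := Setoid.le_def.1 (hm.sup_inf_sup_le θ (K Jᶜ) (K J'ᶜ)) ⟨hsup _ hJ, hsup _ hJ'⟩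
        have hint : (K Jᶜ).toSetoid ⊓ (K J'ᶜ).toSetoid ≤ (K (J ∩ J')ᶜ).toSetoid := by
          refine Setoid.le_def.2 fun {x y} ⟨H, H'⟩ h hh => ?_
          rw [Set.compl_inter] at hh
          exact hh.elim (H h) (H' h)
        exact hab (Setoid.le_def.1 (sup_le le_rfl (hint.trans hle)) hd) }
  have hF : F.NeBot := by
    refine ⟨fun hbot => ?_⟩
    have hmem : (∅ : Set (D →[L] A)) ∈ F := by rw [hbot]; trivial
    refine hmem (Setoid.le_def.2 fun {x y} H => ?_)
    have hxy : x = y := by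
      by_contra hne
      obtain ⟨h, hh⟩ := hD (φ x) (φ y) fun h => hne (φ.injective h)
      exact hh (H h (by simp))
    rw [hxy]
  obtain ⟨g, hg⟩ := exists_limit_hom (Ultrafilter.of F)
  refine ⟨g, fun x y hxy => ?_⟩
  let J : Set (D →[L] A) := {h | h (φ x) = h (φ y)}
  have hJ : J ∈ Ultrafilter.of F := by
    filter_upwards [hg (φ x), hg (φ y)] with h h1 h2
    change h _ = h _
    rw [h1, h2, hxy]
  by_contra hcon
  have hJc : Jᶜ ∈ F := by
    change ¬ _
    rw [compl_compl]
    exact fun hle => hcon (Setoid.le_def.1 hle fun h hh => hh)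
  exact Ultrafilter.compl_notMem_iff.2 hJ (Ultrafilter.of_le F hJc)

/-- All subalgebras of powers of `A` have majority operations. -/
def HasMajority (L : FirstOrder.Language.{0, 0}) [L.IsAlgebraic] (A : Type u) [L.Structure A] :
    Prop :=
  ∀ (B : Type u) [L.Structure B], SeparatedBy L A B → ∃ m : B → B → B → B, IsMajority L m

/-! ### The variety generated by an algebra -/

theorem varietyGen_isVariety (A : Type u) [L.Structure A] : IsVariety L (VarietyGen L A) where
  hom_image B C _ _ h hs hB K hK hA := hK.hom_image B C h hs (hB K hK hA)
  subalgebra B _ S hB K hK hA := hK.subalgebra B S (hB K hK hA)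
  product I B _ hB K hK hA := hK.product I B fun i => hB i K hK hA

theorem varietyGen_self (A : Type u) [L.Structure A] : VarietyGen L A A := fun _ _ hA => hA

/-- Birkhoff's description `V(A) = HSP(A)`, of which only `⊆` is needed. -/
theorem VarietyGen.exists_cover {A E : Type u} [L.Structure A] [L.Structure E]
    (hE : VarietyGen L A E) :
    ∃ (B : Type u) (_ : L.Structure B) (π : B →[L] E),
      SeparatedBy L A B ∧ Function.Surjective π := by
  refine hE (fun E _ => ∃ (B : Type u) (_ : L.Structure B) (π : B →[L] E),
    SeparatedBy L A B ∧ Function.Surjective π) ⟨?_, ?_, ?_⟩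
    ⟨A, inferInstance, Hom.id L A, fun x y h => ⟨Hom.id L A, h⟩, fun x => ⟨x, rfl⟩⟩
  · rintro E F _ _ f hf ⟨B, _, π, hB, hπ⟩
    exact ⟨B, _, f.comp π, hB, hf.comp hπ⟩
  · rintro E _ S ⟨B, _, π, hB, hπ⟩
    refine ⟨S.comap π, inferInstance,
      (π.domRestrict (S.comap π)).codRestrict S fun x => x.2, ?_, ?_⟩
    · intro x y hxy
      obtain ⟨h, hh⟩ := hB x y fun h => hxy (Subtype.ext h)
      exact ⟨h.domRestrict _, hh⟩
    · rintro ⟨s, hs⟩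
      obtain ⟨x, rfl⟩ := hπ s
      exact ⟨⟨x, hs⟩, rfl⟩
  · intro I E _ hE
    choose B hstr π hB hπ using hE
    refine ⟨∀ i, B i, inferInstance,
      { toFun := fun x i => π i (x i)
        map_fun' := fun g x => funext fun i => (π i).map_fun g fun k => x k i
        map_rel' := fun r => isEmptyElim r }, ?_, ?_⟩
    · intro x y hxy
      obtain ⟨i, hi⟩ := Function.ne_iff.1 hxy
      obtain ⟨h, hh⟩ := hB i _ _ hi
      exact ⟨{ toFun := fun z => h (z i)
               map_fun' := fun g z => h.map_fun g fun k => z k i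
               map_rel' := fun r => isEmptyElim r }, hh⟩
    · intro y
      choose x hx using fun i => hπ i (y i)
      exact ⟨x, funext hx⟩

/-- The elements of an algebra in `V(A)` are separated by homomorphisms to homomorphic images of
subalgebras of `A`, when the subpowers of the finite algebra `A` have majority operations. -/
theorem VarietyGen.exists_hom_separating {A E : Type u} [L.Structure A] [L.Structure E] [Finite A]
    (hmaj : HasMajority L A) (hE : VarietyGen L A E) {a b : E} (hab : a ≠ b) :
    ∃ (S : L.Substructure A) (Q : Type u) (_ : L.Structure Q) (π : S →[L] Q) (h : E →[L] Q),
      Function.Surjective π ∧ h a ≠ h b := by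
  obtain ⟨B, _, π, hB, hπ⟩ := hE.exists_cover
  obtain ⟨m, hm⟩ := hmaj B hB
  obtain ⟨a, rfl⟩ := hπ a
  obtain ⟨b, rfl⟩ := hπ b
  obtain ⟨Ψ, hle, hΨ, hmax⟩ := (Congruence.ker π).exists_maximal_omitting hab
  obtain ⟨g, hg⟩ := exists_hom_ker_le (Embedding.refl L B) hB hm Ψ hΨ hmax
  obtain ⟨h, hh⟩ := exists_factor π Ψ.proj hπ fun x y hxy =>
    (Ψ.proj_eq_iff x y).2 (Setoid.le_def.1 hle hxy)
  obtain ⟨q, hq⟩ := exists_factor (rangeRestrict g) Ψ.proj (rangeRestrict_surjective g)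
    fun x y hxy => (Ψ.proj_eq_iff x y).2 (hg x y (congrArg Subtype.val hxy))
  refine ⟨g.range, Ψ.Quot, inferInstance, q, h, fun y => ?_, ?_⟩
  · obtain ⟨x, rfl⟩ := Ψ.proj_surjective y
    exact ⟨_, hq x⟩
  · rw [hh, hh, Ne, Ψ.proj_eq_iff]
    exact hΨ

/-! ### Simple algebras and the extension of homomorphisms -/

theorem IsSimple.injective_or_const {A Q : Type u} [L.Structure A] [L.Structure Q]
    (hA : IsSimple L A) (f : A →[L] Q) : Function.Injective f ∨ ∀ x y, f x = f y := by
  rcases hA (Congruence.ker f) with h | h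
  · refine Or.inl fun x y hxy => ?_
    have : (Congruence.ker f).toSetoid x y := hxy
    rwa [h] at this
  · refine Or.inr fun x y => ?_
    change (Congruence.ker f).toSetoid x y
    rw [h]
    trivial

theorem HasCEP.isSimple_substructure {A : Type u} [L.Structure A] (hcep : HasCEP L A)
    (hA : IsSimple L A) (S : L.Substructure A) : IsSimple L S := by
  intro Θ
  obtain ⟨Φ, hΦ⟩ := hcep S Θ
  rcases hA Φ with h | h <;> rw [h] at hΦ
  · refine Or.inl (Setoid.ext fun x y => (hΦ x y).symm.trans ?_)
    exact Subtype.ext_iff.symm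
  · exact Or.inr (Setoid.ext fun x y => (hΦ x y).symm.trans Iff.rfl)

theorem hasCEP_of_isSimple_substructure {A : Type u} [L.Structure A]
    (hS : ∀ S : L.Substructure A, IsSimple L S) : HasCEP L A := by
  intro S Θ
  rcases hS S Θ with h | h
  · refine ⟨⟨⊥, ?_⟩, fun x y => ?_⟩
    · intro n g x y hxy
      rw [show x = y from funext hxy]
    · rw [h]; exact Subtype.ext_iff.symm
  · exact ⟨⟨⊤, fun _ _ _ _ => trivial⟩, fun x y => by rw [h]; exact Iff.rfl⟩

/-- When all subalgebras of `A` are simple, the kernels of homomorphisms to `A` are maximal or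
full. -/
theorem ker_eq_or_eq_top {A B : Type u} [L.Structure A] [L.Structure B]
    (hS : ∀ S : L.Substructure A, IsSimple L S) (p : B →[L] A) (θ : Congruence L B)
    (hle : ∀ x y, p x = p y → θ.toSetoid x y) :
    (∀ x y, θ.toSetoid x y ↔ p x = p y) ∨ ∀ x y, θ.toSetoid x y := by
  obtain ⟨e, he⟩ := exists_factor (rangeRestrict p) θ.proj (rangeRestrict_surjective p)
    fun x y hxy => (θ.proj_eq_iff x y).2 (hle x y (congrArg Subtype.val hxy))
  rcases (hS p.range).injective_or_const e with h | h
  · refine Or.inl fun x y => ⟨fun hxy => ?_, hle x y⟩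
    rw [← θ.proj_eq_iff, ← he, ← he] at hxy
    exact congrArg Subtype.val (h hxy)
  · refine Or.inr fun x y => ?_
    rw [← θ.proj_eq_iff, ← he, ← he]
    exact h _ _

/-- Homomorphisms to `A` are determined by their kernel and their range. -/
def IsRigid (L : FirstOrder.Language.{0, 0}) [L.IsAlgebraic] (A : Type u) [L.Structure A] : Prop :=
  ∀ (B : Type u) [L.Structure B] (g h : B →[L] A), (∀ x y, g x = g y ↔ h x = h y) →
    g.range = h.range → ∀ x, g x = h x

theorem SeparatedBy.of_embedding {A B D : Type u} [L.Structure A] [L.Structure B] [L.Structure D]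
    (hD : SeparatedBy L A D) (φ : B ↪[L] D) : SeparatedBy L A B := fun x y hxy => by
  obtain ⟨h, hh⟩ := hD (φ x) (φ y) fun h => hxy (φ.injective h)
  exact ⟨h.comp φ.toHom, hh⟩

/-- `A` is injective among the subalgebras of its powers: Jónsson's lemma yields some `g : D → A`
with kernel on `B` below that of `h`, simplicity makes the kernels equal, and then the ranges are
isomorphic, hence equal, and rigidity gives `g = h` on `B`. -/
theorem exists_hom_extension {A B D : Type u} [L.Structure A] [L.Structure B] [L.Structure D]
    [Finite A] (c : L.Functions 0) (hmaj : HasMajority L A) (hrig : IsRigid L A)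
    (hS : ∀ S : L.Substructure A, IsSimple L S) (hiso : NoDistinctIsoSubalgebras L A)
    (hD : SeparatedBy L A D) (φ : B ↪[L] D) (h : B →[L] A) :
    ∃ g : D →[L] A, ∀ b, g (φ b) = h b := by
  by_cases hconst : ∀ x y, h x = h y
  · let e : B := Structure.funMap c ![]
    refine ⟨⟨fun _ => h e, ?_, fun r => isEmptyElim r⟩, fun b => hconst e b⟩
    intro n f x
    change h e = Structure.funMap f (h ∘ fun _ => e)
    rw [← h.map_fun]
    exact hconst _ _
  · push Not at hconst
    obtain ⟨a, b, hab⟩ := hconst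
    obtain ⟨m, hm⟩ := hmaj B (hD.of_embedding φ)
    obtain ⟨g, hg⟩ := exists_hom_ker_le φ hD hm (Congruence.ker h) hab (by
      intro Φ hle hΦ
      rcases ker_eq_or_eq_top hS h Φ fun x y hxy => Setoid.le_def.1 hle hxy with H | H
      · exact Setoid.le_def.2 fun {x y} hxy => (H x y).1 hxy
      · exact absurd (H a b) hΦ)
    have hker : ∀ x y, (g.comp φ.toHom) x = (g.comp φ.toHom) y ↔ h x = h y := by
      rcases ker_eq_or_eq_top hS (g.comp φ.toHom) (Congruence.ker h) hg with H | H
      · exact fun x y => (H x y).symm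
      · exact absurd (H a b) hab
    obtain ⟨e, -⟩ := exists_equiv_of_ker_eq (rangeRestrict (g.comp φ.toHom)) (rangeRestrict h)
      (rangeRestrict_surjective _) (rangeRestrict_surjective _) fun x y => by
        simpa only [Subtype.ext_iff, rangeRestrict_coe] using hker x y
    exact ⟨g, hrig B _ h hker (hiso _ _ ⟨e⟩)⟩

/-- When all subalgebras of `A` are simple, `V(A)` consists of subalgebras of powers of `A`. -/
theorem VarietyGen.separatedBy {A E : Type u} [L.Structure A] [L.Structure E] [Finite A]
    (hmaj : HasMajority L A) (hS : ∀ S : L.Substructure A, IsSimple L S)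
    (hE : VarietyGen L A E) : SeparatedBy L A E := by
  intro a b hab
  obtain ⟨S, Q, _, π, h, hπ, hh⟩ := hE.exists_hom_separating hmaj hab
  rcases (hS S).injective_or_const π with hi | hc
  · obtain ⟨e, he⟩ := exists_factor π S.subtype.toHom hπ fun x y hxy => by rw [hi hxy]
    refine ⟨e.comp h, fun heq => hh ?_⟩
    obtain ⟨x, hx⟩ := hπ (h a)
    obtain ⟨y, hy⟩ := hπ (h b)
    change e (h a) = e (h b) at heq
    rw [← hx, ← hy, he, he] at heq
    rw [← hx, ← hy, Subtype.ext heq]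
  · obtain ⟨x, hx⟩ := hπ (h a)
    obtain ⟨y, hy⟩ := hπ (h b)
    exact absurd (hx ▸ hy ▸ hc x y) hh

/-! ### Amalgamation in the variety generated by a finite simple algebra -/

theorem hasAP_of_hasCEP {A : Type u} [L.Structure A] [Finite A] (c : L.Functions 0)
    (hmaj : HasMajority L A) (hrig : IsRigid L A) (hA : IsSimple L A) (hcep : HasCEP L A)
    (hiso : NoDistinctIsoSubalgebras L A) : HasAP L (VarietyGen L A) := by
  intro B C D _ _ _ _ hC hD φ₁ φ₂
  have hS := hcep.isSimple_substructure hA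
  have hsC := hC.separatedBy hmaj hS
  have hsD := hD.separatedBy hmaj hS
  -- The amalgam is the power of `A` over all pairs of homomorphisms that agree on `B`.
  let I : Type u := {p : (C →[L] A) × (D →[L] A) // ∀ b, p.1 (φ₁ b) = p.2 (φ₂ b)}
  let ψ₁ : C →[L] (I → A) :=
    { toFun := fun x i => i.1.1 x
      map_fun' := fun f x => funext fun i => i.1.1.map_fun f x
      map_rel' := fun r => isEmptyElim r }
  let ψ₂ : D →[L] (I → A) :=
    { toFun := fun x i => i.1.2 x
      map_fun' := fun f x => funext fun i => i.1.2.map_fun f x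
      map_rel' := fun r => isEmptyElim r }
  have h₁ : Function.Injective ψ₁ := by
    intro x y hxy
    by_contra hne
    obtain ⟨h, hh⟩ := hsC x y hne
    obtain ⟨g, hg⟩ := exists_hom_extension c hmaj hrig hS hiso hsD φ₂ (h.comp φ₁.toHom)
    exact hh (congrFun hxy ⟨(h, g), fun b => (hg b).symm⟩)
  have h₂ : Function.Injective ψ₂ := by
    intro x y hxy
    by_contra hne
    obtain ⟨h, hh⟩ := hsD x y hne
    obtain ⟨g, hg⟩ := exists_hom_extension c hmaj hrig hS hiso hsC φ₁ (h.comp φ₂.toHom)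
    exact hh (congrFun hxy ⟨(g, h), hg⟩)
  exact ⟨I → A, inferInstance, Embedding.ofInjective h₁, Embedding.ofInjective h₂,
    (varietyGen_isVariety A).product I (fun _ => A) fun _ => varietyGen_self A,
    fun b => funext fun i => i.2 b⟩

/-- Amalgamating an isomorphism of subalgebras gives an automorphism of `A` that extends it, and
`A` has no automorphisms but the identity. -/
theorem noDistinctIsoSubalgebras_of_hasAP {A : Type u} [L.Structure A] [Finite A]
    (c : L.Functions 0) (hmaj : HasMajority L A) (hrig : IsRigid L A) (hA : IsSimple L A)
    (hap : HasAP L (VarietyGen L A)) : NoDistinctIsoSubalgebras L A := by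
  rintro S T ⟨σ⟩
  have hV := varietyGen_isVariety (L := L) A
  have hVA := varietyGen_self (L := L) A
  obtain ⟨E, _, ψ₁, ψ₂, hE, hψ⟩ := hap S A A (hV.subalgebra A S hVA) hVA hVA S.subtype
    (T.subtype.comp σ.toEmbedding)
  have key : ∀ s : S, (s : A) = σ s := by
    intro s
    by_contra hne
    have hψs : ψ₁ (s : A) = ψ₂ (σ s : A) := hψ s
    obtain ⟨S', Q, _, π, h, hπ, hh⟩ :=
      hE.exists_hom_separating hmaj fun heq => hne (ψ₁.injective heq)
    have hi : Function.Injective (h.comp ψ₁.toHom) :=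
      (hA.injective_or_const _).resolve_right fun hc => hh (hc _ _)
    -- `Q` has at most as many elements as `A`, so the injective map `A → Q` is bijective.
    have hbij : Function.Surjective (h.comp ψ₁.toHom) := by
      have hQ : Finite Q := Finite.of_surjective π hπ
      have h1 : Nat.card Q ≤ Nat.card A :=
        (Nat.card_le_card_of_surjective π hπ).trans
          (Nat.card_le_card_of_injective _ Subtype.val_injective)
      exact ((Nat.bijective_iff_injective_and_card _).2
        ⟨hi, le_antisymm (Nat.card_le_card_of_injective _ hi) h1⟩).2
    rcases hA.injective_or_const (h.comp ψ₂.toHom) with hi₂ | hc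
    · obtain ⟨e, he⟩ := exists_factor (h.comp ψ₁.toHom) (Hom.id L A) hbij fun x y hxy => hi hxy
      have he' : Function.Injective e := by
        intro x y hxy
        obtain ⟨x, rfl⟩ := hbij x
        obtain ⟨y, rfl⟩ := hbij y
        rw [he, he] at hxy
        exact congrArg _ hxy
      have hinj : Function.Injective (e.comp (h.comp ψ₂.toHom)) := he'.comp hi₂
      have hid := hrig A (e.comp (h.comp ψ₂.toHom)) (Hom.id L A)
        (fun x y => ⟨fun hxy => hinj hxy, fun hxy => congrArg _ hxy⟩)
        (by rw [Hom.range_id, Hom.range_eq_top]; exact Finite.injective_iff_surjective.1 hinj)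
        (σ s)
      change e (h (ψ₂ (σ s))) = (σ s : A) at hid
      rw [← hψs] at hid
      exact hne ((he (s : A)).symm.trans hid)
    · -- Here `ψ₂` becomes constant, so that both `s` and `σ s` are the value of the constant `c`.
      let t : S := Structure.funMap c ![]
      have hct : ∀ (M N : Type u) [L.Structure M] [L.Structure N] (f : M →[L] N),
          f (Structure.funMap c ![]) = Structure.funMap c ![] := by
        intro M N _ _ f
        rw [f.map_fun]
        congr 1
        exact Subsingleton.elim _ _
      have hσt : σ t = Structure.funMap c ![] := hct _ _ σ.toHom
      have htS : (t : A) = Structure.funMap c ![] := hct _ _ S.subtype.toHom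
      have htT : ((Structure.funMap c ![] : T) : A) = Structure.funMap c ![] :=
        hct _ _ T.subtype.toHom
      have hst : s = t := by
        refine Subtype.ext (hi ?_)
        change h (ψ₁ (s : A)) = h (ψ₁ (t : A))
        rw [show ψ₁ (t : A) = ψ₂ (σ t : A) from hψ t, hψs]
        exact hc _ _
      exact hne (by rw [hst, hσt, htS, htT])
  ext x
  constructor
  · intro hx
    have h : x = (σ ⟨x, hx⟩ : A) := key ⟨x, hx⟩
    rw [h]
    exact (σ ⟨x, hx⟩).2
  · intro hx
    have h := key (σ.symm ⟨x, hx⟩)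
    rw [σ.apply_symm_apply] at h
    change (σ.symm ⟨x, hx⟩ : A) = x at h
    rw [← h]
    exact (σ.symm ⟨x, hx⟩).2

end UnivAlg

namespace ResLat

open FirstOrder FirstOrder.Language UnivAlg

variable {bdd inv : Bool} {A B : Type u} [(sig bdd inv).Structure A] [(sig bdd inv).Structure B]

/-! ### Operations of residuated lattices -/

theorem map_op₂ (f : A →[sig bdd inv] B) (g : Op bdd inv 2) (x y : A) :
    f (op₂ g x y) = op₂ g (f x) (f y) := by
  refine (f.map_fun (n := 2) g ![x, y]).trans (congrArg _ ?_)
  funext k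
  fin_cases k <;> rfl

theorem coe_op₂ (S : (sig bdd inv).Substructure A) (g : Op bdd inv 2) (x y : S) :
    ((op₂ g x y : S) : A) = op₂ g (x : A) (y : A) := map_op₂ S.subtype.toHom g x y

theorem coe_op₀ (S : (sig bdd inv).Substructure A) (g : Op bdd inv 0) :
    ((op₀ S g : S) : A) = op₀ A g :=
  (S.subtype.toHom.map_fun (n := 0) g ![]).trans (congrArg _ (Subsingleton.elim _ _))

theorem congruence_op₂ (Θ : Congruence (sig bdd inv) A) (g : Op bdd inv 2) {x x' y y' : A}
    (hx : Θ.toSetoid x x') (hy : Θ.toSetoid y y') : Θ.toSetoid (op₂ g x y) (op₂ g x' y') := by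
  refine Θ.compat (n := 2) g _ _ fun k => ?_
  fin_cases k
  exacts [hx, hy]

local infixl:75 " ⋏ " => op₂ (Op.meet : Op bdd inv 2)
local infixl:74 " ⋎ " => op₂ (Op.join : Op bdd inv 2)
local infixl:80 " ⊙ " => op₂ (Op.mul : Op bdd inv 2)
local infixl:78 " ⧵ " => op₂ (Op.ldiv : Op bdd inv 2)
local notation "𝐞" => op₀ _ (Op.unit : Op bdd inv 0)

namespace IsResiduatedLattice

theorem substructure (h : IsResiduatedLattice bdd inv A) (S : (sig bdd inv).Substructure A) :
    IsResiduatedLattice bdd inv S where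
  meet_comm x y := by
    simpa only [Subtype.ext_iff, coe_op₂, coe_op₀] using h.meet_comm x y
  meet_assoc x y z := by
    simpa only [Subtype.ext_iff, coe_op₂, coe_op₀] using h.meet_assoc x y z
  join_comm x y := by
    simpa only [Subtype.ext_iff, coe_op₂, coe_op₀] using h.join_comm x y
  join_assoc x y z := by
    simpa only [Subtype.ext_iff, coe_op₂, coe_op₀] using h.join_assoc x y z
  meet_join x y := by
    simpa only [Subtype.ext_iff, coe_op₂, coe_op₀] using h.meet_join x y
  join_meet x y := by
    simpa only [Subtype.ext_iff, coe_op₂, coe_op₀] using h.join_meet x y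
  mul_assoc x y z := by
    simpa only [Subtype.ext_iff, coe_op₂, coe_op₀] using h.mul_assoc x y z
  one_mul x := by
    simpa only [Subtype.ext_iff, coe_op₂, coe_op₀] using h.one_mul x
  mul_one x := by
    simpa only [Subtype.ext_iff, coe_op₂, coe_op₀] using h.mul_one x
  le_ldiv_iff x y z := by
    simpa only [Subtype.ext_iff, coe_op₂, coe_op₀] using h.le_ldiv_iff x y z
  le_rdiv_iff x y z := by
    simpa only [Subtype.ext_iff, coe_op₂, coe_op₀] using h.le_rdiv_iff x y z
  bot_le hb x := by
    simpa only [Subtype.ext_iff, coe_op₂, coe_op₀] using h.bot_le hb x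
  le_top hb x := by
    simpa only [Subtype.ext_iff, coe_op₂, coe_op₀] using h.le_top hb x
  left_involutive hi x := by
    simpa only [Subtype.ext_iff, coe_op₂, coe_op₀] using h.left_involutive hi x
  right_involutive hi x := by
    simpa only [Subtype.ext_iff, coe_op₂, coe_op₀] using h.right_involutive hi x

theorem meet_self (h : IsResiduatedLattice bdd inv A) (x : A) : x ⋏ x = x := by
  have := h.meet_join x (x ⋏ x)
  rwa [h.join_meet] at this

theorem join_self (h : IsResiduatedLattice bdd inv A) (x : A) : x ⋎ x = x := by
  have := h.join_meet x (x ⋎ x)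
  rwa [h.meet_join] at this

/-- The element `e ∧ z\z' ∧ z'\z` is a witness. -/
theorem exists_le_one_mul_le (h : IsResiduatedLattice bdd inv A) (z z' : A) :
    ∃ w : A, w ⋏ 𝐞 = w ∧
      (z ⊙ w) ⋏ z' = z ⊙ w ∧
      (z' ⊙ w) ⋏ z = z' ⊙ w := by
  refine ⟨𝐞 ⋏ ((z ⧵ z') ⋏ (z' ⧵ z)), ?_, ?_, ?_⟩
  · rw [h.meet_comm, ← h.meet_assoc, h.meet_self]
  · rw [← h.le_ldiv_iff, h.meet_assoc, h.meet_comm (z ⧵ z'), h.meet_assoc, h.meet_self]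
  · rw [← h.le_ldiv_iff, h.meet_assoc, h.meet_assoc, h.meet_self]

/-- In any lattice `(x ∧ y) ∨ (y ∧ z) ∨ (z ∧ x)` is a majority term; its identities pass to
subalgebras of powers. -/
theorem hasMajority (h : IsResiduatedLattice bdd inv A) : HasMajority (sig bdd inv) A := by
  intro B _ hB
  have habs : ∀ x y : A, (x ⋏ y) ⋎ x = x := fun x y => by
    rw [h.join_comm, h.join_meet]
  refine ⟨fun x y z => (x ⋏ y) ⋎ ((y ⋏ z) ⋎ (z ⋏ x)),
    fun x y => ?_, fun x y => ?_, fun x y => ?_, fun Θ _ _ _ _ _ _ hx hy hz => ?_⟩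
  · by_contra hne
    obtain ⟨f, hf⟩ := hB _ _ hne
    refine hf ?_
    simp only [map_op₂]
    rw [h.meet_self, h.meet_comm (f y), h.join_self, h.join_meet]
  · by_contra hne
    obtain ⟨f, hf⟩ := hB _ _ hne
    refine hf ?_
    simp only [map_op₂]
    rw [h.meet_self, h.join_meet, h.meet_comm, habs]
  · by_contra hne
    obtain ⟨f, hf⟩ := hB _ _ hne
    refine hf ?_
    simp only [map_op₂]
    rw [h.meet_self, h.meet_comm (f y), habs, habs]
  · exact congruence_op₂ Θ _ (congruence_op₂ Θ _ hx hy)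
      (congruence_op₂ Θ _ (congruence_op₂ Θ _ hy hz) (congruence_op₂ Θ _ hz hx))

end IsResiduatedLattice

/-! ### Finite chains -/

theorem IsTotallyOrdered.join_eq_or (h : IsResiduatedLattice bdd inv A)
    (hc : IsTotallyOrdered bdd inv A) (x y : A) :
    x ⋎ y = x ∨ x ⋎ y = y := by
  rcases hc x y with hxy | hyx
  · right
    have := h.join_meet y x
    rwa [h.meet_comm, hxy, h.join_comm] at this
  · left
    have := h.join_meet x y
    rwa [h.meet_comm, hyx] at this

/-- The lattice order of a totally ordered residuated lattice. -/
@[reducible]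
noncomputable def chainOrder (h : IsResiduatedLattice bdd inv A)
    (hc : IsTotallyOrdered bdd inv A) : LinearOrder A where
  le x y := x ⋏ y = x
  le_refl := h.meet_self
  le_trans x y z hxy hyz := by
    rw [← hxy, h.meet_assoc, hyz]
  le_antisymm x y hxy hyx := by
    rw [← hxy, h.meet_comm, hyx]
  le_total := hc
  toDecidableLE := Classical.decRel _

/-- Two maps to a well-order that have the same range and induce the same preorder are equal. Only
one inequality is stated, the other follows by symmetry: a value `h x < g x` is also a value `g y`,
and then `h y < h x` is smaller. -/
theorem le_of_range_eq {X W : Type*} [LinearOrder W] [WellFoundedLT W] {g h : X → W}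
    (hgh : ∀ x y, g x ≤ g y ↔ h x ≤ h y) (hr : Set.range g = Set.range h) (x : X) :
    g x ≤ h x := by
  generalize hv : h x = v
  induction v using WellFoundedLT.induction generalizing x with
  | ind v ih =>
    subst hv
    by_contra hlt
    obtain ⟨y, hy⟩ : h x ∈ Set.range g := hr ▸ Set.mem_range_self x
    rw [← hy, hgh, not_le] at hlt
    exact absurd (ih (h y) hlt y rfl) (by rw [hy]; exact not_le.2 hlt)

/-- Homomorphisms to a finite chain with the same kernel induce the same preorder, because order is
expressed by meets. -/
theorem isRigid [Finite A] (h : IsResiduatedLattice bdd inv A)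
    (hc : IsTotallyOrdered bdd inv A) : IsRigid (sig bdd inv) A := by
  intro B _ f g hker hr x
  let _ := chainOrder h hc
  have hle : ∀ x y, f x ≤ f y ↔ g x ≤ g y := fun x y => by
    change (f x) ⋏ (f y) = f x ↔ (g x) ⋏ (g y) = g x
    rw [← map_op₂, ← map_op₂, hker]
  have hr' : Set.range f = Set.range g := by
    rw [← Hom.range_coe, hr, Hom.range_coe]
  exact le_antisymm (le_of_range_eq hle hr' x)
    (le_of_range_eq (fun x y => (hle x y).symm) hr'.symm x)

/-! ### Simplicity of subalgebras from amalgamation -/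

/-- `F` is a homomorphism `S × S → Q`, written as a function of two arguments. If it does not
distinguish `(e, y)` from `(e, e)` for `y ≤ e`, then it depends on its first argument only. -/
theorem eq_of_negative_cone {S Q : Type u} [(sig bdd inv).Structure S] [(sig bdd inv).Structure Q]
    (hS : IsResiduatedLattice bdd inv S)
    (hQ : ∀ x y : Q, x ⋏ y = y ⋏ x)
    {F : S → S → Q} (hF : ∀ (g : Op bdd inv 2) (x x' y y' : S),
      F (op₂ g x x') (op₂ g y y') = op₂ g (F x y) (F x' y'))
    (hcone : ∀ y : S, y ⋏ 𝐞 = y →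
      F 𝐞 y = F 𝐞 𝐞)
    (x y y' : S) : F x y = F x y' := by
  obtain ⟨w, hw, hy, hy'⟩ := hS.exists_le_one_mul_le y y'
  -- Multiplying by `(e, w)` does not change values of `F`.
  have hmul : ∀ z, F x (z ⊙ w) = F x z := fun z => by
    have := hF .mul x 𝐞 z w
    rw [hcone w hw, ← hF, hS.mul_one, hS.mul_one] at this
    exact this
  have key : ∀ z z' : S, (z ⊙ w) ⋏ z' = z ⊙ w →
      (F x z) ⋏ (F x z') = F x z := fun z z' hz => by
    have := hF .meet x x (z ⊙ w) z'
    rw [hz, hS.meet_self, hmul] at this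
    exact this.symm
  rw [← key y y' hy, hQ, key y' y hy']

/-- A homomorphism from `S × S` to an algebra whose order is total depends on one of the two
coordinates only. -/
theorem depends_on_one_coordinate {S Q : Type u} [(sig bdd inv).Structure S]
    [(sig bdd inv).Structure Q] (hS : IsResiduatedLattice bdd inv S)
    (hQ : ∀ x y : Q, x ⋏ y = y ⋏ x)
    (hQ' : ∀ x y : Q, x ⋎ y = x ∨ x ⋎ y = y)
    {F : S → S → Q} (hF : ∀ (g : Op bdd inv 2) (x x' y y' : S),
      F (op₂ g x x') (op₂ g y y') = op₂ g (F x y) (F x' y')) :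
    (∀ x y y', F x y = F x y') ∨ ∀ x x' y, F x y = F x' y := by
  by_cases H : ∀ y : S, y ⋏ 𝐞 = y →
      F 𝐞 y = F 𝐞 𝐞
  · exact Or.inl (eq_of_negative_cone hS hQ hF H)
  · push Not at H
    obtain ⟨y₀, hy₀, hne⟩ := H
    refine Or.inr fun x x' y => ?_
    refine eq_of_negative_cone (F := fun x y => F y x) hS hQ (fun g x x' y y' => hF g y y' x x')
      (fun x hx => ?_) y x x'
    have habs : ∀ z : S, z ⋏ 𝐞 = z →
        𝐞 ⋎ z = 𝐞 := fun z hz => by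
      rw [← hz, hS.meet_comm, hS.join_meet]
    -- `(x, e) ∨ (e, y₀) = (e, e)`, and joins in `Q` are maxima.
    have hj := hF .join x 𝐞 𝐞 y₀
    rw [habs y₀ hy₀, hS.join_comm, habs x hx] at hj
    rcases hQ' (F x 𝐞) (F 𝐞 y₀) with h | h
    · exact (hj.trans h).symm
    · exact absurd (hj.trans h).symm hne

/-- If a congruence `Θ` of a subalgebra `S` is neither the identity nor full, then the span formed
by `S ≤ A` and the embedding of `S` into `S × S/Θ` has no amalgam: a homomorphism from the amalgam
to a chain that separates two elements of `S × S/Θ` with equal first coordinates depends on the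
coordinate in `S/Θ` only, so on `A` it is not injective, hence constant. -/
theorem isSimple_substructure_of_hasAP [Finite A] (h : IsResiduatedLattice bdd inv A)
    (hc : IsTotallyOrdered bdd inv A) (hA : IsSimple (sig bdd inv) A)
    (hap : HasAP (sig bdd inv) (VarietyGen (sig bdd inv) A)) (S : (sig bdd inv).Substructure A) :
    IsSimple (sig bdd inv) S := by
  intro Θ
  by_contra! hΘ
  obtain ⟨hbot, htop⟩ := hΘ
  obtain ⟨s, t, hst, hne⟩ : ∃ s t, Θ.toSetoid s t ∧ s ≠ t := by
    by_contra! H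
    exact hbot (Setoid.ext fun x y => ⟨H x y, fun hxy => hxy ▸ Θ.toSetoid.refl x⟩)
  obtain ⟨z, z', hz⟩ : ∃ z z', ¬ Θ.toSetoid z z' := by
    by_contra! H
    exact htop (Setoid.ext fun x y => ⟨fun _ => trivial, fun _ => H x y⟩)
  have hV := varietyGen_isVariety (L := sig bdd inv) A
  have hVA := varietyGen_self (L := sig bdd inv) A
  have hVS := hV.subalgebra A S hVA
  -- `S × S/Θ` as a quotient of `S × S`, with `S × S` indexed by a type in the right universe.
  let pr : ∀ i : ULift.{u} Bool, (ULift.{u} Bool → S) →[sig bdd inv] S := fun i =>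
    { toFun := fun x => x i
      map_fun' := fun _ _ => rfl
      map_rel' := fun r => isEmptyElim r }
  let Ψ : Congruence (sig bdd inv) (ULift.{u} Bool → S) :=
    (Congruence.ker (pr ⟨true⟩)).inf (Θ.comap (pr ⟨false⟩))
  let pair : S → S → ULift.{u} Bool → S := fun x y i => cond i.down x y
  have hpair : ∀ (g : Op bdd inv 2) (x x' y y' : S),
      pair (op₂ g x x') (op₂ g y y') = op₂ g (pair x y) (pair x' y') := by
    intro g x x' y y'
    funext i
    refine Eq.trans ?_ (map_op₂ (pr i) g _ _).symm
    rcases i with ⟨_ | _⟩ <;> rfl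
  have hVD : VarietyGen (sig bdd inv) A Ψ.Quot :=
    hV.hom_image _ _ Ψ.proj Ψ.proj_surjective (hV.product _ _ fun _ => hVS)
  let δ : S →[sig bdd inv] Ψ.Quot := Ψ.proj.comp
    { toFun := fun x _ => x
      map_fun' := fun _ _ => rfl
      map_rel' := fun r => isEmptyElim r }
  have hδ : ∀ x, δ x = Ψ.proj (pair x x) := fun x => by
    refine congrArg Ψ.proj (funext fun i => ?_)
    rcases i with ⟨_ | _⟩ <;> rfl
  have hδi : Function.Injective δ := fun x y hxy => ((Ψ.proj_eq_iff _ _).1 hxy).1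
  obtain ⟨E, _, ψ₁, ψ₂, hE, hψ⟩ :=
    hap S A Ψ.Quot hVS hVA hVD S.subtype (Embedding.ofInjective hδi)
  have hd : Ψ.proj (pair z z) ≠ Ψ.proj (pair z z') := fun heq =>
    hz ((Ψ.proj_eq_iff _ _).1 heq).2
  obtain ⟨S', Q, _, π, q, hπ, hq⟩ :=
    hE.exists_hom_separating h.hasMajority fun heq => hd (ψ₂.injective heq)
  have hS' := h.substructure S'
  have hQ : ∀ x y : Q, x ⋏ y = y ⋏ x := by
    intro x y
    obtain ⟨x, rfl⟩ := hπ x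
    obtain ⟨y, rfl⟩ := hπ y
    rw [← map_op₂, ← map_op₂, hS'.meet_comm]
  have hQ' : ∀ x y : Q,
      x ⋎ y = x ∨ x ⋎ y = y := by
    intro x y
    obtain ⟨x, rfl⟩ := hπ x
    obtain ⟨y, rfl⟩ := hπ y
    rw [← map_op₂]
    refine (IsTotallyOrdered.join_eq_or hS' (fun x y => ?_) x y).imp (congrArg π) (congrArg π)
    simpa only [Subtype.ext_iff, coe_op₂] using hc x y
  let F : S → S → Q := fun x y => q (ψ₂ (Ψ.proj (pair x y)))
  have hF : ∀ (g : Op bdd inv 2) (x x' y y' : S),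
      F (op₂ g x x') (op₂ g y y') = op₂ g (F x y) (F x' y') := fun g x x' y y' => by
    change q (ψ₂.toHom (Ψ.proj _)) = op₂ g (q (ψ₂.toHom (Ψ.proj _))) (q (ψ₂.toHom (Ψ.proj _)))
    rw [hpair, map_op₂, map_op₂, map_op₂]
  have hfF : ∀ x : S, q (ψ₁ (x : A)) = F x x := fun x => by
    change q (ψ₁ (S.subtype x)) = q (ψ₂ (Ψ.proj (pair x x)))
    rw [hψ, ← hδ]
    rfl
  rcases depends_on_one_coordinate (h.substructure S) hQ hQ' hF with H | H
  · exact hq (H z z z')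
  · have hst' : F s s = F t t := by
      rw [H t s t]
      refine congrArg (fun d => q (ψ₂ d)) ((Ψ.proj_eq_iff _ _).2 ⟨rfl, hst⟩)
    rcases hA.injective_or_const (q.comp ψ₁.toHom) with hi | hconst
    · refine hne (Subtype.ext (hi ?_))
      exact (hfF s).trans (hst'.trans (hfF t).symm)
    · refine hq ?_
      change F z z = F z z'
      rw [H z z' z', ← hfF, ← hfF]
      exact hconst _ _

end ResLat

theorem proposition3p12 (bdd inv : Bool) (A : Type u) [(ResLat.sig bdd inv).Structure A]
    [Finite A] (hRL : ResLat.IsResiduatedLattice bdd inv A)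
    (hchain : ResLat.IsTotallyOrdered bdd inv A)
    (hsimple : UnivAlg.IsSimple (ResLat.sig bdd inv) A) :
    UnivAlg.HasAP (ResLat.sig bdd inv) (UnivAlg.VarietyGen (ResLat.sig bdd inv) A) ↔
      UnivAlg.HasCEP (ResLat.sig bdd inv) A ∧
        UnivAlg.NoDistinctIsoSubalgebras (ResLat.sig bdd inv) A := by
  have hrig := ResLat.isRigid hRL hchain
  have hmaj := hRL.hasMajority
  let c : (ResLat.sig bdd inv).Functions 0 := (.unit : ResLat.Op bdd inv 0)
  exact ⟨fun hap =>
    ⟨UnivAlg.hasCEP_of_isSimple_substructure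
        (ResLat.isSimple_substructure_of_hasAP hRL hchain hsimple hap),
      UnivAlg.noDistinctIsoSubalgebras_of_hasAP c hmaj hrig hsimple hap⟩,
    fun ⟨hcep, hiso⟩ => UnivAlg.hasAP_of_hasCEP c hmaj hrig hsimple hcep hiso⟩
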